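/- Let $p\ge 1$ be an integer. Let $\Omega\subset\mathbb{C}$ be a bounded domain (non-empty connected open set) with $\mathcal{C}^\infty$ smooth boundary, i.e. $\partial\Omega$ consists of finitely many pairwise disjoint regular $\mathcal{C}^\infty$ simple closed curves, each having $\Omega$ locally on exactly one side; orient $\partial\Omega$ positively ($\Omega$ lies to the left). Assume that $0\notin\overline{\Omega}$ and that $\Omega$ is a one-point quadrature domain with respect to the boundary measure $|z|^{-2p}\,dz$: there are a constant $c\in\mathbb{C}$ and a point $z_0\in\Omega$ such that \[\int_{\partial\Omega}\frac{f(z)}{|z|^{2p}}\,dz=c\,f(z_0)\] for every $f\in\mathcal{A}^\infty(\Omega)$, the space of functions that are analytic on $\Omega$ and $\mathcal{C}^\infty$ smooth up to the boundary. Then $\Omega$ is a $p$th root of a disc: there are $a\in\mathbb{C}$, a real number $r$ with $0<r<|a|$, and an analytic branch $g$ of $z^{1/p}$ on the disc $\{|z-a|<r\}$ (so $g(z)^p=z$ there) such that $\Omega=g(\{z:|z-a|<r\})$. -/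

import Mathlib

open scoped ContDiff

/-- `γ 0, …, γ (n - 1)` parametrize the boundary of `Ω` in the positive sense: they are regular
`C^∞` simple closed curves (as functions of period `1`), they are pairwise disjoint, together they
fill the topological boundary of `Ω`, and at each of their points `Ω` lies to the left of the curve
(in the direction `i γ'`) while the exterior of `Ω` lies to the right. -/
structure IsPositiveBoundaryParam (Ω : Set ℂ) {n : ℕ} (γ : Fin n → ℝ → ℂ) : Prop where
  contDiff : ∀ j, ContDiff ℝ ∞ (γ j)
  periodic : ∀ j, Function.Periodic (γ j) 1
  injOn : ∀ j, Set.InjOn (γ j) (Set.Ico 0 1)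
  deriv_ne_zero : ∀ j t, deriv (γ j) t ≠ 0
  disjoint : ∀ j k, j ≠ k → Disjoint (Set.range (γ j)) (Set.range (γ k))
  iUnion_range : ⋃ j, Set.range (γ j) = frontier Ω
  left_mem : ∀ j t, ∀ᶠ s : ℝ in nhdsWithin 0 (Set.Ioi 0),
    γ j t + (s : ℂ) * (Complex.I * deriv (γ j) t) ∈ Ω
  right_notMem : ∀ j t, ∀ᶠ s : ℝ in nhdsWithin 0 (Set.Ioi 0),
    γ j t - (s : ℂ) * (Complex.I * deriv (γ j) t) ∉ closure Ω

/-- A bounded domain in the plane with `C^∞` smooth boundary: a bounded, nonempty, connected open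
set whose boundary consists of finitely many disjoint `C^∞` smooth simple closed curves. -/
structure IsSmoothBoundedDomain (Ω : Set ℂ) : Prop where
  isOpen : IsOpen Ω
  isConnected : IsConnected Ω
  isBounded : Bornology.IsBounded Ω
  exists_param : ∃ (n : ℕ) (γ : Fin n → ℝ → ℂ), IsPositiveBoundaryParam Ω γ

/-- The integral `∫ g(z) dz` along the closed curves `γ j`, each of period `1`. -/
noncomputable def contourIntegral {n : ℕ} (γ : Fin n → ℝ → ℂ) (g : ℂ → ℂ) : ℂ :=
  ∑ j, ∫ t in (0 : ℝ)..1, g (γ j t) * deriv (γ j) t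

/-- The class `𝒜^∞(Ω)` of functions that are analytic on `Ω` and `C^∞` smooth up to the boundary.
Values outside the closure of `Ω` are irrelevant. -/
def SmoothAnalytic (Ω : Set ℂ) : Set (ℂ → ℂ) :=
  {f | AnalyticOnNhd ℂ f Ω ∧ ContDiffOn ℝ ∞ f (closure Ω)}

/-- `Ω` is a one-point quadrature domain with respect to the boundary measure `|z|^{-2p} dz`:
the integral of `f(z) |z|^{-2p} dz` over the positively oriented boundary is `c f(z₀)` for all
`f ∈ 𝒜^∞(Ω)`, with a constant `c` and a node `z₀ ∈ Ω` independent of `f`.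
(The boundary integral does not depend on the positively oriented parametrization.) -/
def IsOnePointBoundaryQuadratureDomain (p : ℕ) (Ω : Set ℂ) : Prop :=
  ∃ (n : ℕ) (γ : Fin n → ℝ → ℂ), IsPositiveBoundaryParam Ω γ ∧
    ∃ c : ℂ, ∃ z₀ ∈ Ω, ∀ f ∈ SmoothAnalytic Ω,
      contourIntegral γ (fun z => f z / ((‖z‖ ^ (2 * p) : ℝ) : ℂ)) = c * f z₀

/-- `Ω` is a `p`th root of a disc: the image of a disc `|z - a| < r` with `0 < r < |a|` under an
analytic branch of `z ^ (1 / p)` on that disc. -/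
def IsRootOfDisc (p : ℕ) (Ω : Set ℂ) : Prop :=
  ∃ (a : ℂ) (r : ℝ), 0 < r ∧ r < ‖a‖ ∧ ∃ g : ℂ → ℂ,
    AnalyticOnNhd ℂ g (Metric.ball a r) ∧ (∀ z ∈ Metric.ball a r, g z ^ p = z) ∧
      Ω = g '' Metric.ball a r

/-! Write `F z = (z ^ p)⁻¹` and `w₀ = F z₀`. For `w` outside the closure, test the quadrature
identity on `(ζ - z₀) * ζ ^ p / (ζ - w)`, which vanishes at the node. Since `‖ζ‖ ^ (2 * p) = ζ ^ p *
conj ζ ^ p`, the Cauchy integral of `(ζ - z₀) / conj ζ ^ p` vanishes on the exterior. Hence this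
boundary function has a holomorphic extension `G` to `Ω`, continuous on the closure
(`exists_diffContOnCl_eqOn`). That step needs the index of the boundary to be `2πi` inside and `0`
outside, which is derived from the local orientation condition through the jump of the index
integral.

Now factor `F - w₀ = Q * (z - z₀)`. On the boundary `G * Q = (F - w₀) * conj F`, so the holomorphic
function `H = G * Q - conj w₀ * (F - w₀)` has the real boundary values `‖F - w₀‖ ^ 2`. It is
therefore a constant `R ^ 2`, and `F` sends the boundary into the circle of radius `R` about `w₀`. A
second preimage of `w₀` would be a zero of `Q`, hence of `H`, which is impossible. So `F` is a
proper local homeomorphism from `Ω` to the disc with a one-point fibre, thus a bijection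
(`bijOn_ball_of_proper`). Inverting the disc, whose closure omits `0`, makes `z ^ p` a bijection
onto a disc, and `g` is its inverse. -/

open Filter Topology MeasureTheory

/-! ### Cauchy kernels along one curve and their jump -/

/-- A Cauchy-type integral is holomorphic off the curve. -/
theorem hasDerivAt_integral_div_sub {γ g : ℝ → ℂ} (hγ : Continuous γ) (hg : Continuous g)
    (hcl : IsClosed (Set.range γ)) {w : ℂ} (hw : w ∉ Set.range γ) (a b : ℝ) :
    HasDerivAt (fun z => ∫ t in a..b, g t / (γ t - z)) (∫ t in a..b, g t / (γ t - w) ^ 2) w := by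
  obtain ⟨δ, hδ, hball⟩ := Metric.isOpen_iff.1 hcl.isOpen_compl w hw
  have hfar : ∀ t, ∀ z ∈ Metric.ball w (δ / 2), δ / 2 ≤ ‖γ t - z‖ := by
    intro t z hz
    have h1 : δ ≤ ‖γ t - w‖ := by
      by_contra! h
      exact hball (by simpa [dist_eq_norm] using h) ⟨t, rfl⟩
    have h2 : ‖z - w‖ < δ / 2 := by simpa [dist_eq_norm] using hz
    have h3 := norm_sub_le_norm_sub_add_norm_sub (γ t) z w
    linarith
  refine (intervalIntegral.hasDerivAt_integral_of_dominated_loc_of_deriv_le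
    (F := fun z t => g t / (γ t - z)) (F' := fun z t => g t / (γ t - z) ^ 2)
    (bound := fun t => ‖g t‖ / (δ / 2) ^ 2) (Metric.ball_mem_nhds w (half_pos hδ))
    ?_ ?_ ?_ ?_ ?_ ?_).2
  · exact Eventually.of_forall fun z =>
      (hg.measurable.div (hγ.measurable.sub_const z)).aestronglyMeasurable
  · refine Continuous.intervalIntegrable (hg.div (hγ.sub continuous_const) fun t h => hw ?_) _ _
    exact ⟨t, sub_eq_zero.1 h⟩
  · exact (hg.measurable.div ((hγ.measurable.sub_const w).pow_const 2)).aestronglyMeasurable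
  · refine Eventually.of_forall fun t _ z hz => ?_
    rw [norm_div, norm_pow]
    have := hfar t z hz
    gcongr
  · exact (hg.norm.div_const _).intervalIntegrable _ _
  · refine Eventually.of_forall fun t _ z hz => ?_
    have hne : γ t - z ≠ 0 := by
      have := hfar t z hz
      exact norm_pos_iff.1 (by linarith)
    have := (((hasDerivAt_id z).const_sub (γ t)).inv hne).const_mul (g t)
    simpa [div_eq_mul_inv] using this

/-- Quantitative comparison of a regular arc through `0` with its tangent line. -/
theorem exists_bound_arc {q : ℝ → ℂ} (hq : ContDiff ℝ ∞ q) (q0 : q 0 = 0) (q1 : deriv q 0 = 1)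
    (hne : ∀ u ∈ Set.Icc (-(1 / 2) : ℝ) (1 / 2), u ≠ 0 → q u ≠ 0) :
    ∃ C c s₀ : ℝ, 0 < C ∧ 0 < c ∧ 0 < s₀ ∧ ∀ u ∈ Set.Icc (-(1 / 2) : ℝ) (1 / 2),
      ‖deriv q u - 1‖ ≤ C * |u| ∧ ‖q u - u‖ ≤ C * |u| * |u| ∧
      ∀ s : ℝ, |s| < s₀ → c * |u| ≤ ‖q u - s * Complex.I‖ := by
  have hdq : Differentiable ℝ q := hq.differentiable (by simp)
  have hq' : ContDiff ℝ ∞ (deriv q) := (contDiff_infty_iff_deriv.1 hq).2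
  have hdq' : Differentiable ℝ (deriv q) := hq'.differentiable (by simp)
  have hq'' : Continuous (deriv (deriv q)) := (contDiff_infty_iff_deriv.1 hq').2.continuous
  obtain ⟨C₀, hC₀⟩ := isCompact_Icc.exists_bound_of_continuousOn
    (s := Set.Icc (-(1 / 2) : ℝ) (1 / 2)) hq''.continuousOn
  set C := max C₀ 1 with hC
  have hCpos : 0 < C := lt_max_of_lt_right one_pos
  have hCb : ∀ u ∈ Set.Icc (-(1 / 2) : ℝ) (1 / 2), ‖deriv (deriv q) u‖ ≤ C := fun u hu =>
    (hC₀ u hu).trans (le_max_left _ _)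
  have h0 : (0 : ℝ) ∈ Set.Icc (-(1 / 2) : ℝ) (1 / 2) := by constructor <;> norm_num
  have b1 : ∀ u ∈ Set.Icc (-(1 / 2) : ℝ) (1 / 2), ‖deriv q u - 1‖ ≤ C * |u| := by
    intro u hu
    have := (convex_Icc (-(1 / 2) : ℝ) (1 / 2)).norm_image_sub_le_of_norm_hasDerivWithin_le
      (f := deriv q) (fun x _ => (hdq' x).hasDerivAt.hasDerivWithinAt) hCb h0 hu
    simpa [q1] using this
  have b2 : ∀ u ∈ Set.Icc (-(1 / 2) : ℝ) (1 / 2), ‖q u - u‖ ≤ C * |u| * |u| := by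
    intro u hu
    have hsub : Set.uIcc 0 u ⊆ Set.Icc (-(1 / 2) : ℝ) (1 / 2) :=
      Set.ordConnected_Icc.uIcc_subset h0 hu
    have := (convex_uIcc (0 : ℝ) u).norm_image_sub_le_of_norm_hasDerivWithin_le
      (f := fun x : ℝ => q x - x) (f' := fun x => deriv q x - 1) (C := C * |u|)
      (fun x _ => ((hdq x).hasDerivAt.sub Complex.ofRealCLM.hasDerivAt).hasDerivWithinAt)
      (fun x hx => (b1 x (hsub hx)).trans (by
        have : |x| ≤ |u| := by simpa using Set.abs_sub_left_of_mem_uIcc hx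
        gcongr))
      Set.left_mem_uIcc Set.right_mem_uIcc
    simpa [q0] using this
  -- For `|u| ≥ 1 / (2 * C)` the tangent line gives no control; there `‖q‖` is bounded below by
  -- compactness.
  have hK : IsCompact (Set.Icc (-(1 / 2) : ℝ) (1 / 2) ∩ {u | 1 / (2 * C) ≤ |u|}) :=
    isCompact_Icc.inter_right (isClosed_le continuous_const continuous_abs)
  obtain ⟨m, hm, hmb⟩ : ∃ m : ℝ, 0 < m ∧ ∀ u ∈ Set.Icc (-(1 / 2) : ℝ) (1 / 2),
      1 / (2 * C) ≤ |u| → m ≤ ‖q u‖ := by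
    rcases Set.eq_empty_or_nonempty (Set.Icc (-(1 / 2) : ℝ) (1 / 2) ∩ {u | 1 / (2 * C) ≤ |u|})
      with he | hne'
    · refine ⟨1, one_pos, fun u hu hu' => ?_⟩
      exact absurd (Set.mem_inter hu hu') (he ▸ Set.notMem_empty u)
    · obtain ⟨x, hx, hmin⟩ := hK.exists_isMinOn hne' hq.continuous.norm.continuousOn
      refine ⟨‖q x‖, norm_pos_iff.2 (hne x hx.1 ?_), fun u hu hu' => hmin ⟨hu, hu'⟩⟩
      rintro rfl
      have h1 : 1 / (2 * C) ≤ |(0 : ℝ)| := hx.2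
      have h2 : 0 < 1 / (2 * C) := by positivity
      rw [abs_zero] at h1
      linarith
  -- Far from `0`, `|s| < m / 2` leaves `m / 2`, which is at least `m * |u|` because `|u| ≤ 1 / 2`.
  -- Near `0`, the quadratic deviation costs at most half of `|u|`.
  refine ⟨C, min (1 / 2) m, m / 2, hCpos, lt_min (by norm_num) hm, half_pos hm, fun u hu =>
    ⟨b1 u hu, b2 u hu, fun s hs => ?_⟩⟩
  have hu2 : |u| ≤ 1 / 2 := abs_le.2 hu
  rcases le_total (1 / (2 * C)) |u| with h | h
  · have h1 := hmb u hu h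
    have h2 : ‖q u‖ - ‖(s : ℂ) * Complex.I‖ ≤ ‖q u - s * Complex.I‖ := norm_sub_norm_le _ _
    have h3 : ‖(s : ℂ) * Complex.I‖ = |s| := by simp
    have h4 : min (1 / 2) m * |u| ≤ m * (1 / 2) := by
      gcongr
      exact min_le_right _ _
    linarith
  · have h1 : |u| ≤ ‖(u : ℂ) - s * Complex.I‖ := by
      simpa using Complex.abs_re_le_norm ((u : ℂ) - s * Complex.I)
    have h2 : ‖(u : ℂ) - s * Complex.I‖ ≤ ‖q u - s * Complex.I‖ + ‖q u - u‖ := by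
      have := norm_sub_le (q u - s * Complex.I) (q u - u)
      simpa using this
    have h3 : C * |u| * |u| ≤ 1 / 2 * |u| := by
      gcongr
      rw [le_div_iff₀ (by positivity)] at h
      linarith
    have h4 : min (1 / 2) m * |u| ≤ 1 / 2 * |u| := by
      gcongr
      exact min_le_left _ _
    have := b2 u hu
    linarith

theorem integral_inv_sub_inv_conj {s : ℝ} (hs : s ≠ 0) :
    ∫ u in (-(1 / 2) : ℝ)..(1 / 2), (1 / ((u : ℂ) - s * Complex.I) -
      1 / ((u : ℂ) - (-s : ℝ) * Complex.I)) =
      4 * Real.arctan (1 / (2 * s)) * Complex.I := by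
  have h : ∀ u : ℝ, (1 / ((u : ℂ) - s * Complex.I) - 1 / ((u : ℂ) - (-s : ℝ) * Complex.I)) =
      (2 * s * Complex.I) * (((s ^ 2 + u ^ 2 : ℝ)⁻¹ : ℝ) : ℂ) := by
    intro u
    have h1 : (u : ℂ) - s * Complex.I ≠ 0 := fun h => hs (by simpa using congrArg Complex.im h)
    have h2 : (u : ℂ) + s * Complex.I ≠ 0 := fun h => hs (by simpa using congrArg Complex.im h)
    have h3 : ((s : ℂ) ^ 2 + u ^ 2) = ((u : ℂ) - s * Complex.I) * (u + s * Complex.I) := by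
      linear_combination (s : ℂ) ^ 2 * Complex.I_sq
    push_cast
    rw [h3, neg_mul, sub_neg_eq_add]
    field_simp
    ring
  simp_rw [h]
  rw [intervalIntegral.integral_const_mul, intervalIntegral.integral_ofReal,
    integral_inv_sq_add_sq hs]
  have : (-(1 / 2) : ℝ) / s = -(1 / (2 * s)) := by field_simp
  rw [this, Real.arctan_neg, show (1 / 2 : ℝ) / s = 1 / (2 * s) by field_simp]
  push_cast
  have : (s : ℂ) ≠ 0 := by exact_mod_cast hs
  field_simp
  ring

/-- Subtracting the kernel of the tangent line leaves an integrand bounded uniformly in `s`, whose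
integral has the same limit from both sides. The jump is thus that of a straight segment, an
explicit arctangent. -/
theorem tendsto_arc_jump {q : ℝ → ℂ} (hq : ContDiff ℝ ∞ q) (q0 : q 0 = 0) (q1 : deriv q 0 = 1)
    (hne : ∀ u ∈ Set.Icc (-(1 / 2) : ℝ) (1 / 2), u ≠ 0 → q u ≠ 0) :
    Tendsto (fun s : ℝ => (∫ u in (-(1 / 2) : ℝ)..(1 / 2), deriv q u / (q u - s * Complex.I)) -
      ∫ u in (-(1 / 2) : ℝ)..(1 / 2), deriv q u / (q u - (-s : ℝ) * Complex.I))
      (𝓝[>] 0) (𝓝 (2 * Real.pi * Complex.I)) := by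
  obtain ⟨C, c, s₀, hC, hc, hs₀, hb⟩ := exists_bound_arc hq q0 q1 hne
  have hq'c : Continuous (deriv q) := (contDiff_infty_iff_deriv.1 hq).2.continuous
  have hI : Set.uIoc (-(1 / 2) : ℝ) (1 / 2) ⊆ Set.Icc (-(1 / 2) : ℝ) (1 / 2) := by
    rw [Set.uIoc_of_le (by norm_num)]
    exact Set.Ioc_subset_Icc_self
  set D : ℝ → ℝ → ℂ := fun s u => deriv q u / (q u - s * Complex.I) - 1 / ((u : ℂ) - s * Complex.I)
    with hD
  have hDlim : Tendsto (fun s => ∫ u in (-(1 / 2) : ℝ)..(1 / 2), D s u) (𝓝 0)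
      (𝓝 (∫ u in (-(1 / 2) : ℝ)..(1 / 2), D 0 u)) := by
    refine intervalIntegral.tendsto_integral_filter_of_dominated_convergence
      (fun _ => C / c + C / c) ?_ ?_ (by simp) ?_
    · refine Eventually.of_forall fun s => Measurable.aestronglyMeasurable ?_
      exact (hq'c.measurable.div (hq.continuous.measurable.sub_const _)).sub
        (measurable_const.div (Complex.measurable_ofReal.sub_const _))
    · have : ∀ᶠ s : ℝ in 𝓝 0, |s| < s₀ := by
        filter_upwards [Metric.ball_mem_nhds (0 : ℝ) hs₀] with s hs
        simpa using hs
      filter_upwards [this] with s hs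
      have hae : ∀ᵐ u : ℝ, u ≠ 0 := by simp [ae_iff]
      filter_upwards [hae] with u hu0 hu
      obtain ⟨h1, h2, h3⟩ := hb u (hI hu)
      have hu' : 0 < |u| := abs_pos.2 hu0
      have h3 := h3 s hs
      have h4 : |u| ≤ ‖(u : ℂ) - s * Complex.I‖ := by
        simpa using Complex.abs_re_le_norm ((u : ℂ) - s * Complex.I)
      have hn1 : q u - s * Complex.I ≠ 0 := norm_pos_iff.1 ((by positivity : 0 < c * |u|).trans_le h3)
      have hn2 : (u : ℂ) - s * Complex.I ≠ 0 := norm_pos_iff.1 (hu'.trans_le h4)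
      -- The numerators are `O(|u|)` and `O(|u| ^ 2)`, matching the lower bounds for the
      -- denominators.
      have hdec : D s u = (deriv q u - 1) / (q u - s * Complex.I) -
          (q u - u) / ((q u - s * Complex.I) * (u - s * Complex.I)) := by
        simp only [hD]
        field_simp
        ring
      rw [hdec]
      refine (norm_sub_le _ _).trans (add_le_add ?_ ?_)
      · rw [norm_div]
        calc _ ≤ (C * |u|) / (c * |u|) := by gcongr
          _ = C / c := by field_simp
      · rw [norm_div, norm_mul]
        calc _ ≤ (C * |u| * |u|) / (c * |u| * |u|) := by gcongr
          _ = C / c := by field_simp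
    · have hae : ∀ᵐ u : ℝ, u ≠ 0 := by simp [ae_iff]
      filter_upwards [hae] with u hu0 hu
      have hcont : ContinuousAt (fun s : ℝ => D s u) 0 := by
        simp only [hD]
        have : q u ≠ 0 := hne u (hI hu) hu0
        refine ContinuousAt.sub (ContinuousAt.div (by fun_prop) (by fun_prop) (by simpa using this))
          (ContinuousAt.div (by fun_prop) (by fun_prop) (by simpa using hu0))
      exact hcont
  have hDneg : Tendsto (fun s : ℝ => ∫ u in (-(1 / 2) : ℝ)..(1 / 2), D (-s) u) (𝓝 0)
      (𝓝 (∫ u in (-(1 / 2) : ℝ)..(1 / 2), D 0 u)) := by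
    refine hDlim.comp ?_
    simpa using (continuous_neg.tendsto (0 : ℝ))
  have harc : Tendsto (fun s : ℝ => (4 * Real.arctan (1 / (2 * s)) * Complex.I : ℂ)) (𝓝[>] 0)
      (𝓝 (2 * Real.pi * Complex.I)) := by
    have h1 : Tendsto (fun s : ℝ => 1 / (2 * s)) (𝓝[>] 0) atTop := by
      have := (tendsto_inv_nhdsGT_zero (𝕜 := ℝ)).const_mul_atTop (by norm_num : (0 : ℝ) < 1 / 2)
      refine this.congr fun s => ?_
      rw [one_div, one_div, mul_inv]
    have h2 := (Real.tendsto_arctan_atTop.mono_right nhdsWithin_le_nhds).comp h1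
    have h3 := (Complex.continuous_ofReal.tendsto _).comp h2
    have h4 := (h3.const_mul (4 : ℂ)).mul_const Complex.I
    have h5 : (4 : ℂ) * ((Real.pi / 2 : ℝ) : ℂ) * Complex.I = 2 * Real.pi * Complex.I := by
      push_cast
      ring
    rwa [h5] at h4
  have key := ((hDlim.sub hDneg).mono_left (nhdsWithin_le_nhds (s := Set.Ioi 0))).add harc
  rw [sub_self, zero_add] at key
  refine key.congr' ?_
  have hsmall : ∀ᶠ s : ℝ in 𝓝[>] 0, s ∈ Set.Ioo 0 s₀ := Ioo_mem_nhdsGT hs₀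
  filter_upwards [hsmall] with s hs
  have hint : ∀ r : ℝ, r ≠ 0 → |r| < s₀ →
      IntervalIntegrable (fun u => deriv q u / (q u - r * Complex.I)) volume (-(1 / 2)) (1 / 2) ∧
      IntervalIntegrable (fun u : ℝ => 1 / ((u : ℂ) - r * Complex.I)) volume (-(1 / 2)) (1 / 2) := by
    intro r hr hr'
    constructor
    · refine ContinuousOn.intervalIntegrable ?_
      rw [Set.uIcc_of_le (by norm_num)]
      refine hq'c.continuousOn.div (hq.continuous.sub continuous_const).continuousOn fun u hu => ?_
      rcases eq_or_ne u 0 with rfl | hu0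
      · simp [q0, hr]
      · refine norm_pos_iff.1 (lt_of_lt_of_le ?_ ((hb u hu).2.2 r hr'))
        exact mul_pos hc (abs_pos.2 hu0)
    · refine Continuous.intervalIntegrable ?_ _ _
      refine continuous_const.div (by fun_prop) fun u h => hr ?_
      simpa using congrArg Complex.im h
  have hs1 : |s| < s₀ := by rw [abs_of_pos hs.1]; exact hs.2
  obtain ⟨i1, i2⟩ := hint s hs.1.ne' hs1
  obtain ⟨i3, i4⟩ := hint (-s) (neg_ne_zero.2 hs.1.ne') (by rwa [abs_neg])
  rw [← integral_inv_sub_inv_conj hs.1.ne']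
  simp only [hD]
  rw [intervalIntegral.integral_sub i1 i2, intervalIntegral.integral_sub i3 i4,
    intervalIntegral.integral_sub i2 i4]
  ring

theorem Function.Periodic.deriv_of_periodic {f : ℝ → ℂ} {c : ℝ} (h : Function.Periodic f c) :
    Function.Periodic (deriv f) c := fun t => by
  rw [← deriv_comp_add_const, h.funext]

theorem Function.Periodic.sub_ne_zero_of_injOn {f : ℝ → ℂ} (h : Function.Periodic f 1)
    (hinj : Set.InjOn f (Set.Ico 0 1)) (t₀ : ℝ) {u : ℝ}
    (hu : u ∈ Set.Icc (-(1 / 2) : ℝ) (1 / 2)) (hu0 : u ≠ 0) : f (t₀ + u) - f t₀ ≠ 0 := by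
  intro hz
  have hfr : ∀ t, f (Int.fract t) = f t := fun t => by
    have := h.sub_zsmul_eq (x := t) ⌊t⌋
    rwa [zsmul_one] at this
  have h1 : Int.fract (t₀ + u) = Int.fract t₀ := by
    refine hinj ⟨Int.fract_nonneg _, Int.fract_lt_one _⟩ ⟨Int.fract_nonneg _, Int.fract_lt_one _⟩ ?_
    rw [hfr, hfr]
    exact sub_eq_zero.1 hz
  obtain ⟨n, hn⟩ := Int.fract_eq_fract.1 h1
  rw [add_sub_cancel_left] at hn
  have h2 : (n : ℝ) < 1 := by rw [← hn]; linarith [hu.2]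
  have h3 : (-1 : ℝ) < n := by rw [← hn]; linarith [hu.1]
  have h4 : n < 1 := by exact_mod_cast h2
  have h5 : -1 < n := by exact_mod_cast h3
  have h6 : n = 0 := by omega
  exact hu0 (by rw [hn, h6, Int.cast_zero])

/-- The jump of the winding number integral across a simple closed curve. -/
theorem tendsto_closed_curve_jump {γ : ℝ → ℂ} (hγ : ContDiff ℝ ∞ γ) (hper : Function.Periodic γ 1)
    (hinj : Set.InjOn γ (Set.Ico 0 1)) (t₀ : ℝ) (hv : deriv γ t₀ ≠ 0) :
    Tendsto (fun s : ℝ =>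
      (∫ t in (0 : ℝ)..1, deriv γ t / (γ t - (γ t₀ + s * (Complex.I * deriv γ t₀)))) -
      ∫ t in (0 : ℝ)..1, deriv γ t / (γ t - (γ t₀ - s * (Complex.I * deriv γ t₀))))
      (𝓝[>] 0) (𝓝 (2 * Real.pi * Complex.I)) := by
  set v := deriv γ t₀ with hvdef
  set q : ℝ → ℂ := fun u => (γ (t₀ + u) - γ t₀) / v with hqdef
  have hq : ContDiff ℝ ∞ q := by
    have : ContDiff ℝ ∞ fun u => γ (t₀ + u) := hγ.comp (contDiff_const.add contDiff_id)
    exact (this.sub contDiff_const).div_const v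
  have hdq : ∀ u, deriv q u = deriv γ (t₀ + u) / v := by
    intro u
    have h1 : HasDerivAt γ (deriv γ (t₀ + u)) (t₀ + u) :=
      (hγ.differentiable (by simp)).differentiableAt.hasDerivAt
    exact (((h1.comp_const_add t₀ u).sub_const (γ t₀)).div_const v).deriv
  have hmain := tendsto_arc_jump hq (by simp [hqdef]) (by rw [hdq, add_zero]; exact div_self hv)
    (fun u hu hu0 => div_ne_zero (hper.sub_ne_zero_of_injOn hinj t₀ hu hu0) hv)
  -- `q` is the curve recentred at `t₀` and divided by its velocity; periodicity moves the window of
  -- length one back to `[0, 1]`.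
  have hshift : ∀ w : ℂ, ∫ u in (-(1 / 2) : ℝ)..(1 / 2), deriv q u / (q u - w) =
      ∫ t in (0 : ℝ)..1, deriv γ t / (γ t - (γ t₀ + w * v)) := by
    intro w
    have hp : Function.Periodic (fun t => deriv γ t / (γ t - (γ t₀ + w * v))) 1 := fun t => by
      simp only [hper t, hper.deriv_of_periodic t]
    have h1 := hp.intervalIntegral_add_eq 0 (t₀ + -(1 / 2))
    rw [zero_add, show t₀ + -(1 / 2) + 1 = t₀ + 1 / 2 by ring] at h1
    rw [h1, ← intervalIntegral.integral_comp_add_left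
      (fun t => deriv γ t / (γ t - (γ t₀ + w * v))) t₀]
    refine intervalIntegral.integral_congr fun u _ => ?_
    rw [hdq]
    simp only [hqdef]
    rw [div_sub' hv, div_div_div_cancel_right₀ hv]
    congr 1
    ring
  refine hmain.congr fun s => ?_
  rw [hshift, hshift]
  congr 4
  all_goals
    ext t
    push_cast
    ring_nf

/-! ### The index of the boundary: `2πi` inside, `0` outside -/

namespace IsPositiveBoundaryParam

variable {Ω : Set ℂ} {n : ℕ} {γ : Fin n → ℝ → ℂ}

theorem isClosed_range (h : IsPositiveBoundaryParam Ω γ) (j : Fin n) :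
    IsClosed (Set.range (γ j)) :=
  ((h.periodic j).compact_of_continuous one_ne_zero (h.contDiff j).continuous).isClosed

theorem mem_frontier (h : IsPositiveBoundaryParam Ω γ) (j : Fin n) (t : ℝ) :
    γ j t ∈ frontier Ω :=
  h.iUnion_range ▸ Set.mem_iUnion.2 ⟨j, t, rfl⟩

theorem continuous_deriv (h : IsPositiveBoundaryParam Ω γ) (j : Fin n) :
    Continuous (deriv (γ j)) :=
  (contDiff_infty_iff_deriv.1 (h.contDiff j)).2.continuous

theorem hasDerivAt (h : IsPositiveBoundaryParam Ω γ) (j : Fin n) (t : ℝ) :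
    HasDerivAt (γ j) (deriv (γ j) t) t :=
  ((h.contDiff j).differentiable (by simp)).differentiableAt.hasDerivAt

theorem notMem_range (h : IsPositiveBoundaryParam Ω γ) {w : ℂ} (hw : w ∉ frontier Ω) (j : Fin n) :
    w ∉ Set.range (γ j) := by
  rintro ⟨t, rfl⟩
  exact hw (h.mem_frontier j t)

/-- Cauchy integrals over the boundary are holomorphic off the boundary. -/
theorem differentiableAt_cauchyIntegral (h : IsPositiveBoundaryParam Ω γ) {φ : ℂ → ℂ}
    (hφ : Continuous φ) {w : ℂ} (hw : w ∉ frontier Ω) :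
    DifferentiableAt ℂ (fun z => contourIntegral γ fun ζ => φ ζ / (ζ - z)) w := by
  unfold contourIntegral
  refine DifferentiableAt.fun_sum fun j _ => ?_
  have := (hasDerivAt_integral_div_sub (g := fun t => φ (γ j t) * deriv (γ j) t)
    (h.contDiff j).continuous ((hφ.comp (h.contDiff j).continuous).mul (h.continuous_deriv j)) (h.isClosed_range j)
    (h.notMem_range hw j) 0 1).differentiableAt
  simpa only [div_mul_eq_mul_div] using this

/-- The differentiated kernel `γ' / (γ - w) ^ 2` has the periodic primitive `-(γ - w)⁻¹`, so it
integrates to zero over each closed curve. -/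
theorem hasDerivAt_index (h : IsPositiveBoundaryParam Ω γ) {w : ℂ} (hw : w ∉ frontier Ω) :
    HasDerivAt (fun z => contourIntegral γ fun ζ => 1 / (ζ - z)) 0 w := by
  unfold contourIntegral
  rw [← Finset.sum_const_zero (s := (Finset.univ : Finset (Fin n))) (M := ℂ)]
  refine HasDerivAt.fun_sum fun j _ => ?_
  have hne : ∀ t, γ j t - w ≠ 0 := fun t ht =>
    h.notMem_range hw j ⟨t, sub_eq_zero.1 ht⟩
  have h1 := hasDerivAt_integral_div_sub (h.contDiff j).continuous (h.continuous_deriv j)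
    (h.isClosed_range j) (h.notMem_range hw j) 0 1
  have h2 : ∫ t in (0 : ℝ)..1, deriv (γ j) t / (γ j t - w) ^ 2 = 0 := by
    rw [intervalIntegral.integral_eq_sub_of_hasDerivAt (f := fun t => -(γ j t - w)⁻¹)]
    · have := h.periodic j 0
      rw [zero_add] at this
      simp [this]
    · intro t _
      have := (((h.hasDerivAt j t).sub_const w).inv (hne t)).neg
      rw [neg_div, neg_neg] at this
      exact this
    · refine Continuous.intervalIntegrable ?_ _ _
      exact (h.continuous_deriv j).div (((h.contDiff j).continuous.sub continuous_const).pow 2)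
        fun t => pow_ne_zero 2 (hne t)
  rw [h2] at h1
  simpa only [div_mul_eq_mul_div, one_mul] using h1

theorem index_eq (h : IsPositiveBoundaryParam Ω γ) {s : Set ℂ} (hs : IsOpen s)
    (hs' : IsPreconnected s) (hd : Disjoint s (frontier Ω)) {z w : ℂ} (hz : z ∈ s) (hw : w ∈ s) :
    contourIntegral γ (fun ζ => 1 / (ζ - z)) = contourIntegral γ (fun ζ => 1 / (ζ - w)) :=
  hs.is_const_of_deriv_eq_zero (f := fun z => contourIntegral γ fun ζ => 1 / (ζ - z)) hs'
    (fun _ hx => (h.hasDerivAt_index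
      (Set.disjoint_left.1 hd hx)).differentiableAt.differentiableWithinAt)
    (fun _ hx => (h.hasDerivAt_index (Set.disjoint_left.1 hd hx)).deriv) hz hw

/-- The jump of the index integral across the boundary. -/
theorem tendsto_index_jump (h : IsPositiveBoundaryParam Ω γ) (j : Fin n) (t₀ : ℝ) :
    Tendsto (fun s : ℝ =>
      contourIntegral γ (fun ζ => 1 / (ζ - (γ j t₀ + s * (Complex.I * deriv (γ j) t₀)))) -
      contourIntegral γ (fun ζ => 1 / (ζ - (γ j t₀ - s * (Complex.I * deriv (γ j) t₀)))))
      (𝓝[>] 0) (𝓝 (2 * Real.pi * Complex.I)) := by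
  unfold contourIntegral
  simp_rw [← Finset.sum_sub_distrib]
  have hsum : ∑ k, (if k = j then (2 * Real.pi * Complex.I : ℂ) else 0) =
      2 * Real.pi * Complex.I := by simp
  rw [← hsum]
  refine tendsto_finsetSum _ fun k _ => ?_
  simp only [div_mul_eq_mul_div, one_mul]
  split_ifs with hk
  · subst hk
    exact tendsto_closed_curve_jump (h.contDiff k) (h.periodic k) (h.injOn k) t₀
      (h.deriv_ne_zero k t₀)
  · have hn : γ j t₀ ∉ Set.range (γ k) :=
      Set.disjoint_left.1 (h.disjoint j k (Ne.symm hk)) ⟨t₀, rfl⟩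
    have hc := (hasDerivAt_integral_div_sub (h.contDiff k).continuous (h.continuous_deriv k)
      (h.isClosed_range k) hn 0 1).continuousAt
    have h1 : Tendsto (fun s : ℝ => γ j t₀ + s * (Complex.I * deriv (γ j) t₀)) (𝓝[>] 0)
        (𝓝 (γ j t₀)) := by
      refine Tendsto.mono_left ?_ nhdsWithin_le_nhds
      refine Continuous.tendsto' (by fun_prop) _ _ (by simp)
    have h2 : Tendsto (fun s : ℝ => γ j t₀ - s * (Complex.I * deriv (γ j) t₀)) (𝓝[>] 0)
        (𝓝 (γ j t₀)) := by
      refine Tendsto.mono_left ?_ nhdsWithin_le_nhds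
      refine Continuous.tendsto' (by fun_prop) _ _ (by simp)
    have := (hc.tendsto.comp h1).sub (hc.tendsto.comp h2)
    rwa [sub_self] at this

theorem tendsto_index_atTop (h : IsPositiveBoundaryParam Ω γ) :
    Tendsto (fun x : ℝ => contourIntegral γ (fun ζ => 1 / (ζ - (x : ℂ)))) atTop (𝓝 0) := by
  unfold contourIntegral
  rw [← Finset.sum_const_zero (s := (Finset.univ : Finset (Fin n))) (M := ℂ)]
  refine tendsto_finsetSum _ fun j _ => ?_
  obtain ⟨M, hM⟩ := (isCompact_Icc (a := (0 : ℝ)) (b := 1)).exists_bound_of_continuousOn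
    (h.contDiff j).continuous.continuousOn
  obtain ⟨K, hK⟩ := (isCompact_Icc (a := (0 : ℝ)) (b := 1)).exists_bound_of_continuousOn
    (h.continuous_deriv j).continuousOn
  have hlim : Tendsto (fun x : ℝ => K / (x + -M)) atTop (𝓝 0) :=
    tendsto_const_nhds.div_atTop (tendsto_atTop_add_const_right _ _ tendsto_id)
  refine squeeze_zero_norm' ?_ hlim
  filter_upwards [eventually_gt_atTop M, eventually_gt_atTop 0] with x hx hx0
  refine (intervalIntegral.norm_integral_le_of_norm_le_const (C := K / (x + -M)) ?_).trans
    (by simp)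
  intro t ht
  rw [Set.uIoc_of_le zero_le_one] at ht
  have ht' := Set.Ioc_subset_Icc_self ht
  have h1 : x + -M ≤ ‖γ j t - x‖ := by
    have h2 := norm_sub_norm_le (x : ℂ) (γ j t)
    rw [Complex.norm_of_nonneg hx0.le, norm_sub_rev] at h2
    have h3 := hM t ht'
    linarith
  have hpos : 0 < x + -M := by linarith
  rw [div_mul_eq_mul_div, one_mul, norm_div]
  have h4 := hK t ht'
  have h5 : 0 ≤ K := (norm_nonneg _).trans h4
  gcongr

/-- Join `w` to a nearest point of the closure. The segment is normal to the boundary there and its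
interior stays in the exterior, so the jump at that point compares the index at `w` with the index
in `Ω`. This handles bounded components of the exterior as well. -/
theorem index_sub_index (h : IsPositiveBoundaryParam Ω γ) (ho : IsOpen Ω) (hc : IsPreconnected Ω)
    (hb : Bornology.IsBounded Ω) {z w : ℂ} (hz : z ∈ Ω) (hw : w ∉ closure Ω) :
    contourIntegral γ (fun ζ => 1 / (ζ - z)) - contourIntegral γ (fun ζ => 1 / (ζ - w)) =
      2 * Real.pi * Complex.I := by
  obtain ⟨b, hbm, hbd⟩ := hb.isCompact_closure.exists_infDist_eq_dist ⟨z, subset_closure hz⟩ w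
  have hball : Disjoint (Metric.ball w (dist w b)) (closure Ω) :=
    hbd ▸ Metric.disjoint_ball_infDist
  have hd : 0 < dist w b := dist_pos.2 fun e => hw (e ▸ hbm)
  have hbΩ : b ∉ Ω := fun hbΩ => by
    have h1 : b ∈ closure (Metric.ball w (dist w b)) := by
      rw [closure_ball w hd.ne']
      simp [dist_comm]
    obtain ⟨x, hx1, hx2⟩ := mem_closure_iff.1 h1 Ω ho hbΩ
    exact Set.disjoint_left.1 hball hx2 (subset_closure hx1)
  have hbf : b ∈ frontier Ω := by
    rw [ho.frontier_eq]
    exact ⟨hbm, hbΩ⟩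
  rw [← h.iUnion_range] at hbf
  obtain ⟨j, t₀, rfl⟩ := Set.mem_iUnion.1 hbf
  set v := deriv (γ j) t₀ with hvdef
  have hv : v ≠ 0 := h.deriv_ne_zero j t₀
  have hperp : inner ℝ (γ j t₀ - w) v = 0 := by
    have hmin : IsLocalMin (fun t => ‖γ j t - w‖ ^ 2) t₀ := by
      refine Eventually.of_forall fun t => ?_
      have h1 : dist w (γ j t₀) ≤ dist w (γ j t) := by
        rw [← hbd]
        exact Metric.infDist_le_dist_of_mem (frontier_subset_closure (h.mem_frontier j t))
      rw [dist_comm w, dist_comm w, dist_eq_norm, dist_eq_norm] at h1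
      simp only
      gcongr
    have := hmin.hasDerivAt_eq_zero ((h.hasDerivAt j t₀).sub_const w).norm_sq
    linarith
  obtain ⟨r, hr⟩ : ∃ r : ℝ, w = γ j t₀ + r * (Complex.I * v) := by
    have hIv : Complex.I * v ≠ 0 := mul_ne_zero Complex.I_ne_zero hv
    refine ⟨((w - γ j t₀) / (Complex.I * v)).re, ?_⟩
    have him : ((w - γ j t₀) / (Complex.I * v)).im = 0 := by
      rw [Complex.inner] at hperp
      simp only [Complex.mul_re, Complex.conj_re, Complex.conj_im, Complex.sub_re,
        Complex.sub_im] at hperp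
      rw [Complex.div_im, ← sub_div, div_eq_zero_iff]
      left
      simp only [Complex.mul_re, Complex.mul_im, Complex.I_re, Complex.I_im, Complex.sub_re,
        Complex.sub_im]
      linear_combination hperp
    rw [(Complex.ext rfl (by simp [him]) :
      ((((w - γ j t₀) / (Complex.I * v)).re : ℝ) : ℂ) = (w - γ j t₀) / (Complex.I * v))]
    field_simp
    ring
  have hdr : dist w (γ j t₀) = |r| * ‖v‖ := by
    rw [dist_eq_norm, hr]
    simp
  have hmem : ∀ s : ℝ, |r - s| < |r| → γ j t₀ + s * (Complex.I * v) ∈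
      Metric.ball w (dist w (γ j t₀)) := by
    intro s hs
    rw [Metric.mem_ball, hdr, dist_comm, dist_eq_norm]
    have : w - (γ j t₀ + s * (Complex.I * v)) = ((r - s : ℝ) : ℂ) * (Complex.I * v) := by
      rw [hr]
      push_cast
      ring
    rw [this, norm_mul, norm_mul, Complex.norm_I, one_mul, Complex.norm_real, Real.norm_eq_abs]
    have := norm_pos_iff.2 hv
    gcongr
  have hr0 : r ≠ 0 := fun h0 => by
    rw [hdr, h0] at hd
    simp at hd
  -- If `r` were positive, points of `Ω` just to the left of the curve would lie in the ball about
  -- `w` that misses the closure.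
  have hrneg : r < 0 := by
    by_contra! hr'
    have hrpos : 0 < r := lt_of_le_of_ne hr' hr0.symm
    obtain ⟨s, hs1, hs2⟩ := ((h.left_mem j t₀).and (Ioo_mem_nhdsGT hrpos)).exists
    refine Set.disjoint_left.1 hball (hmem s ?_) (subset_closure hs1)
    rw [abs_of_pos hrpos, abs_of_pos (by linarith [hs2.2])]
    linarith [hs2.1]
  refine tendsto_nhds_unique (tendsto_const_nhds.congr' ?_) (h.tendsto_index_jump j t₀)
  filter_upwards [h.left_mem j t₀, Ioo_mem_nhdsGT (neg_pos.2 hrneg)] with s hs1 hs2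
  congr 1
  · refine h.index_eq ho hc ?_ hz hs1
    rw [ho.frontier_eq]
    exact Set.disjoint_sdiff_right
  · refine h.index_eq Metric.isOpen_ball (convex_ball w (dist w (γ j t₀))).isPreconnected
      (hball.mono_right frontier_subset_closure) (Metric.mem_ball_self hd) ?_
    have := hmem (-s) (by
      rw [abs_of_neg hrneg, abs_of_neg (by linarith [hs2.2])]
      linarith [hs2.1])
    simpa [sub_eq_add_neg] using this

/-- Comparison with one interior point gives the same value on the whole exterior, and the integral
tends to `0` at infinity. -/
theorem index_eq_zero (h : IsPositiveBoundaryParam Ω γ) (ho : IsOpen Ω) (hc : IsConnected Ω)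
    (hb : Bornology.IsBounded Ω) {w : ℂ} (hw : w ∉ closure Ω) :
    contourIntegral γ (fun ζ => 1 / (ζ - w)) = 0 := by
  obtain ⟨z, hz⟩ := hc.nonempty
  have hconst : ∀ w' ∉ closure Ω, contourIntegral γ (fun ζ => 1 / (ζ - w')) =
      contourIntegral γ (fun ζ => 1 / (ζ - w)) := fun w' hw' => by
    have h1 := h.index_sub_index ho hc.isPreconnected hb hz hw
    have h2 := h.index_sub_index ho hc.isPreconnected hb hz hw'
    linear_combination h1 - h2
  obtain ⟨M, hM⟩ := isBounded_iff_forall_norm_le.1 hb.closure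
  refine tendsto_nhds_unique (tendsto_const_nhds.congr' ?_) h.tendsto_index_atTop
  filter_upwards [eventually_gt_atTop M, eventually_gt_atTop 0] with x hx hx0
  refine (hconst x fun hx' => ?_).symm
  have := hM x hx'
  rw [Complex.norm_of_nonneg hx0.le] at this
  linarith

theorem index_eq_two_pi_I (h : IsPositiveBoundaryParam Ω γ) (ho : IsOpen Ω) (hc : IsConnected Ω)
    (hb : Bornology.IsBounded Ω) {z : ℂ} (hz : z ∈ Ω) :
    contourIntegral γ (fun ζ => 1 / (ζ - z)) = 2 * Real.pi * Complex.I := by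
  obtain ⟨w, hw⟩ : ∃ w, w ∉ closure Ω := by
    by_contra! hall
    have := hb.closure
    rw [Set.eq_univ_of_forall hall] at this
    exact NoncompactSpace.noncompact_univ (X := ℂ)
      (Metric.isCompact_of_isClosed_isBounded isClosed_univ this)
  rw [← h.index_sub_index ho hc.isPreconnected hb hz hw, h.index_eq_zero ho hc hb hw, sub_zero]

end IsPositiveBoundaryParam

/-! ### Holomorphic extension of boundary data -/

/-- Regularized Cauchy integrals of a Lipschitz density depend continuously on the pole, also on the
curve itself. -/
theorem continuous_integral_slope {γ g : ℝ → ℂ} {Φ : ℂ → ℂ} {K : NNReal} (hΦ : LipschitzWith K Φ)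
    (hγ : Continuous γ) (hg : Continuous g) (hinj : Set.InjOn γ (Set.Ico 0 1)) :
    Continuous fun z => ∫ t in (0 : ℝ)..1, (Φ (γ t) - Φ z) / (γ t - z) * g t := by
  refine continuous_iff_continuousAt.2 fun z₀ => ?_
  refine intervalIntegral.continuousAt_of_dominated_interval (bound := fun t => K * ‖g t‖) ?_ ?_
    ((continuous_const.mul hg.norm).intervalIntegrable _ _) ?_
  · refine Eventually.of_forall fun z => Measurable.aestronglyMeasurable ?_
    exact (((hΦ.continuous.comp hγ).measurable.sub_const _).div
      (hγ.measurable.sub_const _)).mul hg.measurable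
  · refine Eventually.of_forall fun z => Eventually.of_forall fun t _ => ?_
    rw [norm_mul, norm_div]
    gcongr
    refine div_le_of_le_mul₀ (norm_nonneg _) K.coe_nonneg ?_
    simpa [dist_eq_norm] using hΦ.dist_le_mul (γ t) z
  -- By injectivity the curve meets `z₀` for at most one parameter in `[0, 1)`, so the integrand is
  -- continuous in `z` at `z₀` for almost every `t`.
  · have hnull : volume ((Set.Ico 0 1 ∩ γ ⁻¹' {z₀}) ∪ {1}) = 0 := by
      refine Set.Subsingleton.measure_zero ?_ _ |> fun h => measure_union_null h (by simp)
      intro s hs t ht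
      exact hinj hs.1 ht.1 (hs.2.trans ht.2.symm)
    filter_upwards [compl_mem_ae_iff.2 hnull] with t ht htI
    rw [Set.uIoc_of_le zero_le_one] at htI
    have hne : γ t - z₀ ≠ 0 := by
      intro h0
      refine ht ?_
      rcases eq_or_lt_of_le htI.2 with h1 | h1
      · exact Or.inr h1
      · exact Or.inl ⟨⟨htI.1.le, h1⟩, sub_eq_zero.1 h0⟩
    exact (((continuousAt_const.sub hΦ.continuous.continuousAt).div
      (continuousAt_const.sub continuousAt_id) hne).mul continuousAt_const)

namespace IsPositiveBoundaryParam

variable {Ω : Set ℂ} {n : ℕ} {γ : Fin n → ℝ → ℂ}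

theorem contourIntegral_slope (h : IsPositiveBoundaryParam Ω γ) {Φ : ℂ → ℂ} (hΦ : Continuous Φ)
    {z : ℂ} (hz : z ∉ frontier Ω) :
    contourIntegral γ (fun ζ => (Φ ζ - Φ z) / (ζ - z)) =
      contourIntegral γ (fun ζ => Φ ζ / (ζ - z)) -
        Φ z * contourIntegral γ (fun ζ => 1 / (ζ - z)) := by
  unfold contourIntegral
  rw [Finset.mul_sum, ← Finset.sum_sub_distrib]
  refine Finset.sum_congr rfl fun j _ => ?_
  have hγ := (h.contDiff j).continuous
  have hne : ∀ t, γ j t - z ≠ 0 := fun t ht =>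
    h.notMem_range hz j ⟨t, sub_eq_zero.1 ht⟩
  have hγ' := h.continuous_deriv j
  rw [← intervalIntegral.integral_const_mul, ← intervalIntegral.integral_sub]
  · refine intervalIntegral.integral_congr fun t _ => ?_
    simp only
    ring
  · exact (((hΦ.comp hγ).div (hγ.sub continuous_const) hne).mul hγ').intervalIntegrable _ _
  · exact (continuous_const.mul ((continuous_const.div (hγ.sub continuous_const) hne).mul
      hγ')).intervalIntegrable _ _

/-- A Lipschitz function whose Cauchy integral over the boundary vanishes outside the domain
has the same boundary values as a function holomorphic in the domain. -/
theorem exists_diffContOnCl_eqOn (h : IsPositiveBoundaryParam Ω γ) (ho : IsOpen Ω)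
    (hc : IsConnected Ω) (hb : Bornology.IsBounded Ω) {Φ : ℂ → ℂ} {K : NNReal}
    (hΦ : LipschitzWith K Φ)
    (hvan : ∀ w ∉ closure Ω, contourIntegral γ (fun ζ => Φ ζ / (ζ - w)) = 0) :
    ∃ G : ℂ → ℂ, DiffContOnCl ℂ G Ω ∧ Set.EqOn G Φ (frontier Ω) := by
  set W : ℂ → ℂ := fun z => contourIntegral γ (fun ζ => (Φ ζ - Φ z) / (ζ - z)) with hW
  have hWc : Continuous W := by
    simp only [hW]
    unfold contourIntegral
    exact continuous_finsetSum _ fun j _ => continuous_integral_slope hΦ (h.contDiff j).continuous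
      (h.continuous_deriv j) (h.injOn j)
  have hWext : ∀ w ∉ closure Ω, W w = 0 := fun w hw => by
    simp only [hW]
    rw [h.contourIntegral_slope hΦ.continuous fun hf => hw (frontier_subset_closure hf), hvan w hw,
      h.index_eq_zero ho hc hb hw, mul_zero, sub_zero]
  have hWfr : ∀ b ∈ frontier Ω, W b = 0 := fun b hbf => by
    rw [← h.iUnion_range] at hbf
    obtain ⟨j, t₀, rfl⟩ := Set.mem_iUnion.1 hbf
    have h1 : Tendsto (fun s : ℝ => γ j t₀ - s * (Complex.I * deriv (γ j) t₀)) (𝓝[>] 0)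
        (𝓝 (γ j t₀)) := by
      refine Tendsto.mono_left ?_ nhdsWithin_le_nhds
      refine Continuous.tendsto' (by fun_prop) _ _ (by simp)
    refine tendsto_nhds_unique ((hWc.tendsto _).comp h1) (tendsto_const_nhds.congr' ?_)
    filter_upwards [h.right_notMem j t₀] with s hs
    exact (hWext _ hs).symm
  -- On `Ω` the index is `2πi`, so this is the Cauchy integral of `Φ` over `2πi`. On the boundary
  -- `W` vanishes, as a limit along the outward normal.
  refine ⟨fun z => Φ z + W z / (2 * Real.pi * Complex.I), ⟨?_, ?_⟩, fun b hbf => by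
    simp [hWfr b hbf]⟩
  · intro z hz
    have hU : DifferentiableAt ℂ (fun z => contourIntegral γ (fun ζ => Φ ζ / (ζ - z)) /
        (2 * Real.pi * Complex.I)) z := by
      refine (h.differentiableAt_cauchyIntegral hΦ.continuous ?_).div_const _
      rw [ho.frontier_eq]
      exact fun hz' => hz'.2 hz
    refine hU.differentiableWithinAt.congr (fun x hx => ?_) ?_
    all_goals
      simp only [hW]
      rw [h.contourIntegral_slope hΦ.continuous
        (by rw [ho.frontier_eq]; exact fun hx' => hx'.2 (by assumption)),
        h.index_eq_two_pi_I ho hc hb (by assumption)]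
      have := Complex.two_pi_I_ne_zero
      field_simp
      ring
  · exact (hΦ.continuous.add (hWc.div_const _)).continuousOn

end IsPositiveBoundaryParam

/-! ### Rigidity, proper maps and inverses -/

/-- A holomorphic function with real boundary values is constant. -/
theorem DiffContOnCl.exists_eq_const_of_im_eq_zero {Ω : Set ℂ} (ho : IsOpen Ω)
    (hc : IsConnected Ω) (hb : Bornology.IsBounded Ω) {H : ℂ → ℂ} (hH : DiffContOnCl ℂ H Ω)
    (him : ∀ z ∈ frontier Ω, (H z).im = 0) : ∃ k : ℂ, ∀ z ∈ closure Ω, H z = k := by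
  -- For imaginary `c`, `exp (c * H)` has modulus one on the boundary; the maximum principle with `c
  -- = ±I` then forces `H` to be real throughout.
  have hexp : ∀ c : ℂ, c.re = 0 → ∀ z ∈ closure Ω, (c * H z).re ≤ 0 := by
    intro c hcre z hz
    have hd : DiffContOnCl ℂ (fun z => Complex.exp (c * H z)) Ω :=
      Complex.differentiable_exp.comp_diffContOnCl (hH.const_smul c)
    have := Complex.norm_le_of_forall_mem_frontier_norm_le hb hd (C := 1) (fun z hz => by
      rw [Complex.norm_exp, Complex.mul_re, him z hz, hcre]
      simp) hz
    rwa [Complex.norm_exp, Real.exp_le_one_iff] at this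
  have hreal : ∀ z ∈ closure Ω, (H z).im = 0 := fun z hz => by
    have h1 := hexp Complex.I (by simp) z hz
    have h2 := hexp (-Complex.I) (by simp) z hz
    simp only [neg_mul, Complex.neg_re, Complex.I_mul_re] at h1 h2
    linarith
  have hconst : ∃ k, ∀ z ∈ Ω, H z = k := by
    rcases (hH.differentiableOn.analyticOnNhd ho).is_constant_or_isOpen hc.isPreconnected with h | h
    · exact h
    · exfalso
      have hop := h Ω subset_rfl ho
      obtain ⟨z, hz⟩ := hc.nonempty
      obtain ⟨ε, hε, hball⟩ := Metric.isOpen_iff.1 hop (H z) ⟨z, hz, rfl⟩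
      obtain ⟨y, hy, hy'⟩ : H z + (ε / 2 : ℝ) * Complex.I ∈ H '' Ω := hball (by
        simp [dist_eq_norm, abs_of_pos hε, hε])
      have h1 := hreal y (subset_closure hy)
      rw [hy'] at h1
      simp [hreal z (subset_closure hz), hε.ne'] at h1
  obtain ⟨k, hk⟩ := hconst
  exact ⟨k, fun z hz => (Set.EqOn.of_subset_closure (f := H) (g := fun _ => k) hk hH.continuousOn
    continuousOn_const subset_closure subset_rfl) hz⟩

/-- A proper local homeomorphism onto a disc with a one-point fibre is a bijection. -/
theorem bijOn_ball_of_proper {Ω : Set ℂ} (ho : IsOpen Ω) (hb : Bornology.IsBounded Ω)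
    {F F' : ℂ → ℂ} {w₀ : ℂ} {R : ℝ} (hF : ContinuousOn F (closure Ω))
    (hF' : ∀ z ∈ Ω, HasStrictDerivAt F (F' z) z) (hF'0 : ∀ z ∈ Ω, F' z ≠ 0)
    (hin : Set.MapsTo F Ω (Metric.ball w₀ R)) (hfr : ∀ z ∈ frontier Ω, F z ∉ Metric.ball w₀ R)
    {z₀ : ℂ} (hz₀ : z₀ ∈ Ω) (hw₀ : F z₀ = w₀) (huniq : ∀ z ∈ Ω, F z = w₀ → z = z₀) :
    Set.BijOn F Ω (Metric.ball w₀ R) := by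
  have hop : ∀ s ⊆ Ω, IsOpen s → IsOpen (F '' s) := fun s hs hso => by
    refine isOpen_iff_mem_nhds.2 ?_
    rintro _ ⟨z, hz, rfl⟩
    rw [← (hF' z (hs hz)).map_nhds_eq (hF'0 z (hs hz))]
    exact image_mem_map (hso.mem_nhds hz)
  have hback : ∀ z ∈ closure Ω, F z ∈ Metric.ball w₀ R → z ∈ Ω := fun z hz hzb => by
    by_contra hzΩ
    exact hfr z (by rw [ho.frontier_eq]; exact ⟨hz, hzΩ⟩) hzb
  have hpre : IsPreconnected (Metric.ball w₀ R) := (convex_ball w₀ R).isPreconnected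
  have hw₀R : w₀ ∈ Metric.ball w₀ R := hw₀ ▸ hin hz₀
  refine ⟨hin, ?_, ?_⟩
  -- `B` is the set of values taken at least twice. It is open and relatively closed in the disc, so
  -- if nonempty it would contain `w₀`, contradicting the one-point fibre.
  · set A : Set (ℂ × ℂ) := {x | x.1 ∈ Ω ∧ x.2 ∈ Ω ∧ F x.1 = F x.2 ∧ x.1 ≠ x.2} with hA
    set B : Set ℂ := (fun x : ℂ × ℂ => F x.1) '' A with hB
    have hBo : IsOpen B := by
      refine isOpen_iff_mem_nhds.2 ?_
      rintro _ ⟨⟨x, y⟩, ⟨hx, hy, hxy, hne⟩, rfl⟩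
      simp only at hx hy hxy hne ⊢
      obtain ⟨U, V, hU, hV, hxU, hyV, hUV⟩ := t2_separation hne
      have h1 := (hop _ Set.inter_subset_right (hU.inter ho)).mem_nhds ⟨x, ⟨hxU, hx⟩, rfl⟩
      have h2 := (hop _ Set.inter_subset_right (hV.inter ho)).mem_nhds ⟨y, ⟨hyV, hy⟩, rfl⟩
      rw [← hxy] at h2
      filter_upwards [h1, h2]
      rintro _ ⟨x', hx', rfl⟩ ⟨y', hy', hxy'⟩
      refine ⟨(x', y'), ⟨hx'.2, hy'.2, hxy'.symm, ?_⟩, rfl⟩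
      rintro (rfl : x' = y')
      exact Set.disjoint_left.1 hUV hx'.1 hy'.1
    have hBc : closure B ∩ Metric.ball w₀ R ⊆ B := by
      rintro w ⟨hwB, hwR⟩
      have hAcl : closure A ⊆ closure Ω ×ˢ closure Ω := by
        rw [← closure_prod_eq]
        exact closure_mono fun x hx => ⟨hx.1, hx.2.1⟩
      have hcompact : IsCompact (closure A) :=
        (hb.isCompact_closure.prod hb.isCompact_closure).of_isClosed_subset isClosed_closure hAcl
      have hc1 : ContinuousOn (fun x : ℂ × ℂ => F x.1) (closure A) :=
        hF.comp continuousOn_fst fun x hx => (hAcl hx).1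
      have hc2 : ContinuousOn (fun x : ℂ × ℂ => F x.2) (closure A) :=
        hF.comp continuousOn_snd fun x hx => (hAcl hx).2
      have hEq : Set.EqOn (fun x : ℂ × ℂ => F x.1) (fun x : ℂ × ℂ => F x.2) (closure A) :=
        Set.EqOn.of_subset_closure (fun x hx => hx.2.2.1) hc1 hc2 subset_closure subset_rfl
      have hcl : IsClosed ((fun x : ℂ × ℂ => F x.1) '' closure A) :=
        (hcompact.image_of_continuousOn hc1).isClosed
      obtain ⟨⟨x, y⟩, hxy, rfl⟩ := closure_minimal (Set.image_mono subset_closure) hcl hwB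
      have hFxy : F x = F y := hEq hxy
      have hx : x ∈ Ω := hback x (hAcl hxy).1 hwR
      have hy : y ∈ Ω := hback y (hAcl hxy).2 (hFxy ▸ hwR)
      refine ⟨(x, y), ⟨hx, hy, hFxy, ?_⟩, rfl⟩
      rintro (rfl : x = y)
      -- Two distinct preimages cannot merge in the limit, because `F` is injective near `x`.
      have hinv := (hF' x hx).eventually_left_inverse (hF'0 x hx)
      obtain ⟨⟨x', y'⟩, hxy', hmem⟩ := mem_closure_iff_nhds.1 hxy _ (prod_mem_nhds hinv hinv)
      refine hmem.2.2.2 ?_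
      have h1 := hxy'.1
      have h2 := hxy'.2
      have h3 : F x' = F y' := hmem.2.2.1
      dsimp only [Set.mem_ofPred_eq] at h1 h2
      rw [← h1, ← h2, h3]
    by_contra hninj
    obtain ⟨x, hx, y, hy, hxy, hne⟩ : ∃ x ∈ Ω, ∃ y ∈ Ω, F x = F y ∧ x ≠ y := by
      simpa [Set.InjOn] using hninj
    have := hpre.subset_of_closure_inter_subset hBo
      ⟨F x, hin hx, (x, y), ⟨hx, hy, hxy, hne⟩, rfl⟩ hBc hw₀R
    obtain ⟨⟨x', y'⟩, ⟨hx', hy', hxy', hne'⟩, hFx'⟩ := this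
    simp only at hx' hy' hxy' hne' hFx'
    exact hne' ((huniq x' hx' hFx').trans (huniq y' hy' (hxy' ▸ hFx')).symm)
  · refine hpre.subset_of_closure_inter_subset (hop Ω subset_rfl ho) ⟨F z₀, hin hz₀, z₀, hz₀, rfl⟩ ?_
    rintro w ⟨hw, hwR⟩
    obtain ⟨z, hz, rfl⟩ := closure_minimal (Set.image_mono subset_closure)
      (hb.isCompact_closure.image_of_continuousOn hF).isClosed hw
    exact ⟨z, hback z hz hwR, rfl⟩

/-- A holomorphic bijection with nonvanishing derivative has a holomorphic inverse. -/
theorem exists_analytic_inverse {Ω B : Set ℂ} (ho : IsOpen Ω) (hB : IsOpen B) {P P' : ℂ → ℂ}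
    (hP : ∀ z ∈ Ω, HasStrictDerivAt P (P' z) z) (hP' : ∀ z ∈ Ω, P' z ≠ 0)
    (hbij : Set.BijOn P Ω B) :
    ∃ g : ℂ → ℂ, AnalyticOnNhd ℂ g B ∧ (∀ z ∈ B, P (g z) = z) ∧ Ω = g '' B := by
  set g := Function.invFunOn P Ω with hg
  have hinv : Set.InvOn g P Ω B := hbij.invOn_invFunOn
  have hmaps : Set.MapsTo g B Ω := hbij.surjOn.mapsTo_invFunOn
  refine ⟨g, DifferentiableOn.analyticOnNhd (fun w hw => ?_) hB, hinv.2, ?_⟩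
  · have hcont : ContinuousAt g w := by
      intro V hV
      have h1 : V ∩ Ω ∈ 𝓝 (g w) := inter_mem hV (ho.mem_nhds (hmaps hw))
      have h2 : P '' (V ∩ Ω) ∈ 𝓝 w := by
        have := image_mem_map (m := P) h1
        rwa [(hP _ (hmaps hw)).map_nhds_eq (hP' _ (hmaps hw)), hinv.2 hw] at this
      refine mem_map.2 ?_
      filter_upwards [h2]
      rintro _ ⟨z, hz, rfl⟩
      rw [Set.mem_preimage, hinv.1 hz.2]
      exact hz.1
    refine (HasDerivAt.of_local_left_inverse hcont (hP _ (hmaps hw)).hasDerivAt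
      (hP' _ (hmaps hw)) ?_).differentiableAt.differentiableWithinAt
    filter_upwards [hB.mem_nhds hw] with y hy using hinv.2 hy
  · refine Set.Subset.antisymm (fun z hz => ⟨P z, hbij.mapsTo hz, hinv.1 hz⟩) ?_
    rintro _ ⟨w, hw, rfl⟩
    exact hmaps hw

/-- The inversion `w ↦ w⁻¹` maps a disc not containing the origin to a disc. -/
theorem inv_mem_ball_iff {w w₀ : ℂ} {R : ℝ} (hR : 0 < R) (hR' : R < ‖w₀‖) (hw : w ≠ 0) :
    w⁻¹ ∈ Metric.ball ((starRingEnd ℂ) w₀ / ((‖w₀‖ ^ 2 - R ^ 2 : ℝ) : ℂ)) (R / (‖w₀‖ ^ 2 - R ^ 2)) ↔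
      w ∈ Metric.ball w₀ R := by
  have hN : 0 < ‖w₀‖ ^ 2 - R ^ 2 := by nlinarith
  set N := ‖w₀‖ ^ 2 - R ^ 2 with hNdef
  have hNc : (N : ℂ) ≠ 0 := by exact_mod_cast hN.ne'
  rw [Metric.mem_ball, Metric.mem_ball, dist_eq_norm, dist_eq_norm]
  have h1 : w⁻¹ - (starRingEnd ℂ) w₀ / (N : ℂ) = (N - w * (starRingEnd ℂ) w₀) / (w * N) := by
    field_simp
  have hwn : 0 < ‖w‖ := norm_pos_iff.2 hw
  rw [h1, norm_div, norm_mul, Complex.norm_of_nonneg hN.le, div_lt_div_iff₀ (by positivity) hN,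
    ← mul_assoc, mul_lt_mul_iff_left₀ hN, ← sq_lt_sq₀ (norm_nonneg _) (by positivity),
    ← sq_lt_sq₀ (norm_nonneg _) hR.le, mul_pow, ← sub_neg, ← sub_neg (b := R ^ 2)]
  have h2 : ‖N - w * (starRingEnd ℂ) w₀‖ ^ 2 - R ^ 2 * ‖w‖ ^ 2 = N * (‖w - w₀‖ ^ 2 - R ^ 2) := by
    rw [hNdef]
    simp only [Complex.sq_norm, Complex.normSq_apply, Complex.sub_re, Complex.sub_im,
      Complex.mul_re, Complex.mul_im, Complex.conj_re, Complex.conj_im, Complex.ofReal_re,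
      Complex.ofReal_im]
    ring
  rw [h2]
  constructor
  · intro h
    exact (pos_iff_neg_of_mul_neg h).1 hN
  · exact mul_neg_of_pos_of_neg hN

/-! ### Using the quadrature identity -/

/-- A smooth cutoff, equal to one on `K` and zero near `0` and far away, removes the singularity and
gives compact support, hence a global Lipschitz constant. -/
theorem exists_lipschitz_eqOn_conj_pow {K : Set ℂ} (hK : IsCompact K) (h0 : (0 : ℂ) ∉ K) (p : ℕ)
    (z₀ : ℂ) : ∃ (Φ : ℂ → ℂ) (L : NNReal), LipschitzWith L Φ ∧
      ∀ z ∈ K, Φ z = (z - z₀) / (starRingEnd ℂ) z ^ p := by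
  obtain ⟨ε, hε, hεK⟩ := Metric.isOpen_iff.1 hK.isClosed.isOpen_compl 0 h0
  obtain ⟨M, hM⟩ := isBounded_iff_forall_norm_le.1 hK.isBounded
  have hs : IsClosed (Metric.closedBall (0 : ℂ) (ε / 2) ∪ (Metric.ball 0 (M + 1))ᶜ) :=
    Metric.isClosed_closedBall.union Metric.isOpen_ball.isClosed_compl
  have hdisj : Disjoint (Metric.closedBall (0 : ℂ) (ε / 2) ∪ (Metric.ball 0 (M + 1))ᶜ) K := by
    refine Set.disjoint_left.2 fun z hz hzK => ?_
    rcases hz with hz | hz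
    · exact hεK (Metric.closedBall_subset_ball (half_lt_self hε) hz) hzK
    · refine hz ?_
      have := hM z hzK
      rw [mem_ball_zero_iff]
      linarith
  obtain ⟨f, hf, -, hf0, hf1⟩ := exists_contMDiff_zero_iff_one_iff_of_isClosed (n := ⊤)
    (modelWithCornersSelf ℝ ℂ) hs hK.isClosed hdisj
  have hf := hf.contDiff
  set Φ : ℂ → ℂ := fun z => f z * ((z - z₀) / (starRingEnd ℂ) z ^ p) with hΦ
  have hsm : ContDiff ℝ ∞ Φ := by
    refine contDiff_iff_contDiffAt.2 fun z => ?_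
    rcases eq_or_ne z 0 with rfl | hz
    · refine (contDiffAt_const (c := (0 : ℂ))).congr_of_eventuallyEq ?_
      filter_upwards [Metric.ball_mem_nhds (0 : ℂ) (half_pos hε)] with y hy
      simp [hΦ, (hf0 y).1 (Or.inl (Metric.ball_subset_closedBall hy))]
    · simp only [hΦ, div_eq_mul_inv]
      refine ContDiffAt.mul ?_ (ContDiffAt.mul ?_ (ContDiffAt.inv ?_ ?_))
      · exact (Complex.ofRealCLM.contDiff.comp hf).contDiffAt
      · exact (contDiff_id.sub contDiff_const).contDiffAt
      · exact (Complex.conjCLE.contDiff.pow p).contDiffAt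
      · simpa using fun h => absurd h hz
  have hcs : HasCompactSupport Φ := by
    refine HasCompactSupport.intro (isCompact_closedBall (0 : ℂ) (M + 1)) fun z hz => ?_
    have : f z = 0 := (hf0 z).1 (Or.inr fun h => hz (Metric.ball_subset_closedBall h))
    simp [hΦ, this]
  obtain ⟨L, hL⟩ := hsm.lipschitzWith_of_hasCompactSupport hcs (by simp)
  exact ⟨Φ, L, hL, fun z hz => by simp [hΦ, (hf1 z).1 hz]⟩

theorem IsPositiveBoundaryParam.contourIntegral_congr {Ω : Set ℂ} {n : ℕ} {γ : Fin n → ℝ → ℂ}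
    (h : IsPositiveBoundaryParam Ω γ) {f g : ℂ → ℂ} (hfg : Set.EqOn f g (frontier Ω)) :
    contourIntegral γ f = contourIntegral γ g := by
  unfold contourIntegral
  refine Finset.sum_congr rfl fun j _ => intervalIntegral.integral_congr fun t _ => ?_
  simp only [hfg (h.mem_frontier j t)]

theorem mul_pow_div_mem_smoothAnalytic {Ω : Set ℂ} (ho : IsOpen Ω) (p : ℕ) (z₀ : ℂ) {w : ℂ}
    (hw : w ∉ closure Ω) : (fun ζ => (ζ - z₀) * ζ ^ p / (ζ - w)) ∈ SmoothAnalytic Ω := by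
  have hne : ∀ ζ ∈ closure Ω, ζ - w ≠ 0 := fun ζ hζ h => hw (sub_eq_zero.1 h ▸ hζ)
  refine ⟨DifferentiableOn.analyticOnNhd (fun ζ hζ => ?_) ho, ?_⟩
  · exact (DifferentiableAt.fun_div (c := fun ζ => (ζ - z₀) * ζ ^ p) (d := fun ζ => ζ - w)
      (by fun_prop) (by fun_prop) (hne ζ (subset_closure hζ))).differentiableWithinAt
  · simp only [div_eq_mul_inv]
    refine ContDiffOn.mul (ContDiff.contDiffOn (by fun_prop)) (ContDiffOn.inv ?_ hne)
    exact (contDiff_id.sub contDiff_const).contDiffOn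

/-- The function `(z - z₀) / conj z ^ p` on the boundary of a one-point quadrature domain extends
holomorphically to the domain. -/
theorem exists_holomorphic_extension {p : ℕ} {Ω : Set ℂ} (hΩ : IsSmoothBoundedDomain Ω)
    (h0 : (0 : ℂ) ∉ closure Ω) (hq : IsOnePointBoundaryQuadratureDomain p Ω) :
    ∃ z₀ ∈ Ω, ∃ G : ℂ → ℂ, DiffContOnCl ℂ G Ω ∧
      ∀ z ∈ frontier Ω, G z = (z - z₀) / (starRingEnd ℂ) z ^ p := by
  obtain ⟨n, γ, h, c, z₀, hz₀, hquad⟩ := hq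
  obtain ⟨Φ, L, hL, hΦ⟩ :=
    exists_lipschitz_eqOn_conj_pow hΩ.isBounded.isCompact_closure h0 p z₀
  obtain ⟨G, hG, hGΦ⟩ := h.exists_diffContOnCl_eqOn hΩ.isOpen hΩ.isConnected hΩ.isBounded hL
    (fun w hw => by
      have h1 := hquad _ (mul_pow_div_mem_smoothAnalytic hΩ.isOpen p z₀ hw)
      simp only [sub_self, zero_mul, zero_div, mul_zero] at h1
      rw [← h1]
      refine h.contourIntegral_congr fun ζ hζ => ?_
      have hζc := frontier_subset_closure hζ
      have hζ0 : ζ ≠ 0 := fun e => h0 (e ▸ hζc)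
      have hζ0' : (starRingEnd ℂ) ζ ≠ 0 := by simpa using hζ0
      have hζw : ζ - w ≠ 0 := fun e => hw (sub_eq_zero.1 e ▸ hζc)
      rw [hΦ ζ hζc, pow_mul]
      push_cast
      rw [← Complex.mul_conj', mul_pow]
      field_simp)
  exact ⟨z₀, hz₀, G, hG, fun z hz => (hGΦ hz).trans (hΦ z (frontier_subset_closure hz))⟩

theorem hasStrictDerivAt_inv_pow (p : ℕ) {z : ℂ} (hz : z ≠ 0) :
    HasStrictDerivAt (fun z : ℂ => (z ^ p)⁻¹) (-(p * z ^ (p - 1)) / (z ^ p) ^ 2) z := by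
  have h := (hasStrictDerivAt_inv (pow_ne_zero p hz)).comp z (hasStrictDerivAt_pow p z)
  rwa [show -((z ^ p) ^ 2)⁻¹ * (p * z ^ (p - 1)) = -(p * z ^ (p - 1)) / (z ^ p) ^ 2 by ring] at h

/-- In a one-point quadrature domain, `z ↦ (z ^ p)⁻¹` is a bijection onto a disc. -/
theorem exists_bijOn_inv_pow {p : ℕ} (hp : 1 ≤ p) {Ω : Set ℂ} (hΩ : IsSmoothBoundedDomain Ω)
    (h0 : (0 : ℂ) ∉ closure Ω) (hq : IsOnePointBoundaryQuadratureDomain p Ω) :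
    ∃ (w₀ : ℂ) (R : ℝ), 0 < R ∧ Set.BijOn (fun z : ℂ => (z ^ p)⁻¹) Ω (Metric.ball w₀ R) := by
  obtain ⟨z₀, hz₀, G, hG, hGfr⟩ := exists_holomorphic_extension hΩ h0 hq
  have ho := hΩ.isOpen
  have hb := hΩ.isBounded
  have hne : ∀ z ∈ closure Ω, z ≠ 0 := fun z hz e => h0 (e ▸ hz)
  have hz₀0 : z₀ ≠ 0 := hne z₀ (subset_closure hz₀)
  set F : ℂ → ℂ := fun z => (z ^ p)⁻¹ with hF
  set w₀ : ℂ := F z₀ with hw₀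
  set Q : ℂ → ℂ := fun z =>
    -(z ^ p * z₀ ^ p)⁻¹ * ∑ i ∈ Finset.range p, z ^ i * z₀ ^ (p - 1 - i) with hQ
  have hFQ : ∀ z ∈ closure Ω, F z - w₀ = Q z * (z - z₀) := fun z hz => by
    have h1 := (Commute.all z z₀).geom_sum₂_mul p
    simp only [hF, hw₀, hQ]
    rw [mul_assoc, h1]
    have := pow_ne_zero p (hne z hz)
    have := pow_ne_zero p hz₀0
    field_simp
    ring
  have hFd : DiffContOnCl ℂ F Ω := DifferentiableOn.diffContOnCl fun z hz =>
    (hasStrictDerivAt_inv_pow p (hne z hz)).hasDerivAt.differentiableAt.differentiableWithinAt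
  have hQd : DiffContOnCl ℂ Q Ω := DifferentiableOn.diffContOnCl fun z hz => by
    have := mul_ne_zero (pow_ne_zero p (hne z hz)) (pow_ne_zero p hz₀0)
    refine DifferentiableAt.differentiableWithinAt (DifferentiableAt.mul
      (DifferentiableAt.neg (DifferentiableAt.inv (by fun_prop) this)) (by fun_prop))
  set H : ℂ → ℂ := fun z => G z * Q z - (starRingEnd ℂ) w₀ * (F z - w₀) with hH
  have hHd : DiffContOnCl ℂ H Ω :=
    (hG.smul hQd).sub ((hFd.sub_const w₀).const_smul ((starRingEnd ℂ) w₀))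
  have hHfr : ∀ z ∈ frontier Ω, H z = ((‖F z - w₀‖ ^ 2 : ℝ) : ℂ) := fun z hz => by
    have hzc := frontier_subset_closure hz
    have h1 : G z * Q z = (F z - w₀) * (starRingEnd ℂ) (F z) := by
      rw [hGfr z hz, hFQ z hzc]
      simp only [hF, map_inv₀, map_pow]
      ring
    push_cast
    rw [← Complex.mul_conj', map_sub]
    simp only [hH]
    rw [h1]
    ring
  obtain ⟨k, hk⟩ := hHd.exists_eq_const_of_im_eq_zero ho hΩ.isConnected hb fun z hz => by
    rw [hHfr z hz, Complex.ofReal_im]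
  obtain ⟨b, hbf⟩ : (frontier Ω).Nonempty :=
    nonempty_frontier_iff.2 ⟨⟨z₀, hz₀⟩, fun e => h0 (by simp [e])⟩
  set R := ‖F b - w₀‖ with hR
  have hkR : k = ((R ^ 2 : ℝ) : ℂ) := by rw [← hk b (frontier_subset_closure hbf), hHfr b hbf]
  have hRfr : ∀ z ∈ frontier Ω, ‖F z - w₀‖ = R := fun z hz => by
    have h1 := (hHfr z hz).symm.trans ((hk z (frontier_subset_closure hz)).trans hkR)
    exact (sq_eq_sq₀ (norm_nonneg _) (norm_nonneg _)).1 (by exact_mod_cast h1)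
  have hRcl : ∀ z ∈ closure Ω, ‖F z - w₀‖ ≤ R := fun z hz =>
    Complex.norm_le_of_forall_mem_frontier_norm_le hb (hFd.sub_const w₀)
      (fun z hz => (hRfr z hz).le) hz
  have hF' : ∀ z ∈ Ω, HasStrictDerivAt F (-(p * z ^ (p - 1)) / (z ^ p) ^ 2) z := fun z hz =>
    hasStrictDerivAt_inv_pow p (hne z (subset_closure hz))
  have hF'0 : ∀ z ∈ Ω, (-(p * z ^ (p - 1)) / (z ^ p) ^ 2 : ℂ) ≠ 0 := fun z hz => by
    have h1 := hne z (subset_closure hz)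
    have h2 : (p : ℂ) ≠ 0 := by exact_mod_cast (by omega : p ≠ 0)
    exact div_ne_zero (neg_ne_zero.2 (mul_ne_zero h2 (pow_ne_zero _ h1)))
      (pow_ne_zero _ (pow_ne_zero _ h1))
  have hRpos : 0 < R := by
    refine lt_of_le_of_ne (norm_nonneg _) fun hR0 => hF'0 z₀ hz₀ ?_
    have h1 : F =ᶠ[𝓝 z₀] fun _ => w₀ := by
      filter_upwards [ho.mem_nhds hz₀] with z hz
      have := hRcl z (subset_closure hz)
      rw [← hR0, norm_le_zero_iff, sub_eq_zero] at this
      exact this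
    exact (hF' z₀ hz₀).hasDerivAt.unique ((hasDerivAt_const z₀ w₀).congr_of_eventuallyEq h1)
  -- The maximum principle gives only the closed disc; openness of `F` puts the image in its
  -- interior.
  have hin : Set.MapsTo F Ω (Metric.ball w₀ R) := fun z hz => by
    rw [← interior_closedBall w₀ hRpos.ne', mem_interior_iff_mem_nhds,
      ← (hF' z hz).map_nhds_eq (hF'0 z hz)]
    refine mem_map.2 ?_
    filter_upwards [ho.mem_nhds hz] with y hy
    simpa [dist_eq_norm] using hRcl y (subset_closure hy)
  refine ⟨w₀, R, hRpos, bijOn_ball_of_proper ho hb hFd.continuousOn hF' hF'0 hin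
    (fun z hz => ?_) hz₀ rfl fun z hz hzw => ?_⟩
  · rw [Metric.mem_ball, dist_eq_norm, hRfr z hz]
    exact lt_irrefl R
  · by_contra hzz
    have h1 : Q z = 0 := by
      have := hFQ z (subset_closure hz)
      rw [hzw, sub_self] at this
      exact (mul_eq_zero.1 this.symm).resolve_right (sub_ne_zero.2 hzz)
    have h2 := (hk z (subset_closure hz)).trans hkR
    simp only [hH, h1, hzw, sub_self, mul_zero] at h2
    have h3 : (0 : ℝ) = R ^ 2 := by exact_mod_cast h2
    exact (pow_pos hRpos 2).ne h3

theorem mainTheorem9 (p : ℕ) (hp : 1 ≤ p) (Ω : Set ℂ) (hΩ : IsSmoothBoundedDomain Ω)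
    (h0 : (0 : ℂ) ∉ closure Ω) (hq : IsOnePointBoundaryQuadratureDomain p Ω) :
    IsRootOfDisc p Ω := by
  obtain ⟨w₀, R, hR, hbij⟩ := exists_bijOn_inv_pow hp hΩ h0 hq
  have hne : ∀ z ∈ closure Ω, z ≠ 0 := fun z hz e => h0 (e ▸ hz)
  -- Otherwise `0` lies in the closed disc, which is contained in the compact image of the closure;
  -- but `(z ^ p)⁻¹` never vanishes there.
  have hRw : R < ‖w₀‖ := by
    by_contra! hle
    have hcont : ContinuousOn (fun z : ℂ => (z ^ p)⁻¹) (closure Ω) := fun z hz =>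
      (hasStrictDerivAt_inv_pow p (hne z hz)).hasDerivAt.continuousAt.continuousWithinAt
    have h1 : (0 : ℂ) ∈ closure (Metric.ball w₀ R) := by
      rw [closure_ball w₀ hR.ne']
      simpa using hle
    obtain ⟨z, hz, hz0⟩ := closure_minimal
      (hbij.image_eq ▸ Set.image_mono subset_closure)
      (hΩ.isBounded.isCompact_closure.image_of_continuousOn hcont).isClosed h1
    exact inv_ne_zero (pow_ne_zero p (hne z hz)) hz0
  have hN : 0 < ‖w₀‖ ^ 2 - R ^ 2 := by nlinarith
  set a : ℂ := (starRingEnd ℂ) w₀ / ((‖w₀‖ ^ 2 - R ^ 2 : ℝ) : ℂ) with ha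
  set r : ℝ := R / (‖w₀‖ ^ 2 - R ^ 2) with hr
  have hra : r < ‖a‖ := by
    rw [ha, norm_div, Complex.norm_of_nonneg hN.le, RCLike.norm_conj, hr]
    gcongr
  have hmem : ∀ {w : ℂ}, w ≠ 0 → (w⁻¹ ∈ Metric.ball a r ↔ w ∈ Metric.ball w₀ R) := fun hw =>
    inv_mem_ball_iff hR hRw hw
  have hbij' : Set.BijOn (fun z : ℂ => z ^ p) Ω (Metric.ball a r) := by
    refine ⟨fun z hz => ?_, fun x hx y hy hxy => ?_, fun ζ hζ => ?_⟩
    · have h1 := (hmem (inv_ne_zero (pow_ne_zero p (hne z (subset_closure hz))))).2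
        (hbij.mapsTo hz)
      rwa [inv_inv] at h1
    · exact hbij.injOn hx hy (congrArg (·⁻¹) hxy)
    · have hζ0 : ζ ≠ 0 := by
        rintro rfl
        rw [Metric.mem_ball, dist_zero_left] at hζ
        exact hζ.not_gt hra
      obtain ⟨z, hz, hzζ⟩ := hbij.surjOn ((hmem (inv_ne_zero hζ0)).1 (by rwa [inv_inv]))
      exact ⟨z, hz, inv_injective hzζ⟩
  have hp0 : (p : ℂ) ≠ 0 := by exact_mod_cast (by omega : p ≠ 0)
  exact ⟨a, r, div_pos hR hN, hra, exists_analytic_inverse hΩ.isOpen Metric.isOpen_ball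
    (fun z _ => hasStrictDerivAt_pow p z)
    (fun z hz => mul_ne_zero hp0 (pow_ne_zero _ (hne z (subset_closure hz)))) hbij'⟩
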